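/- Let $n\ge 1$ and let $\mathcal K(\rho)=\sum_{j=1}^d K_j\rho K_j^\dagger$, with $K_j\in\mathbb C^{n\times n}$ and $\sum_{j=1}^d K_j^\dagger K_j=I$, be a quantum channel on an $n$-dimensional system $B$. For positive semidefinite $\rho,\sigma$ let $F(\rho,\sigma)=\operatorname{Tr}\sqrt{\rho^{1/2}\sigma\rho^{1/2}}$ be the fidelity, and let $$F_{\min}(\mathcal K)=\inf_{|\Psi\rangle}F\big(|\Psi\rangle\langle\Psi|,\,(I_A\otimes\mathcal K_B)(|\Psi\rangle\langle\Psi|)\big)$$ be the minimum entanglement fidelity, where the infimum is over all unit vectors $|\Psi\rangle$ of $A\otimes B$ with an ancillary system $A$ of any finite dimension. For a unitary matrix $U$ let $\|U\|=\max|\theta|$, where $\theta$ runs over the angles in $(-\pi,\pi]$ for which $e^{-i\theta}$ is an eigenvalue of $U$. Let the time-energy cost of $\mathcal K$ be $$\|\mathcal K\|=\inf_U\|U\|,$$ where the infimum is over all unitaries $U$ on $C\otimes B$, with an ancillary system $C$ of any finite dimension prepared in a standard unit state $|0\rangle$, such that $\mathcal K(\rho)=\operatorname{Tr}_C\big[U(|0\rangle\langle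 0|\otimes\rho)U^\dagger\big]$ for all $\rho$. Then $$F_{\min}(\mathcal K)\ \ge\ \cos\|\mathcal K\| .$$ -/

import Mathlib

open scoped Matrix Kronecker MatrixOrder ComplexOrder

noncomputable section

/-- A quantum channel on `n`-dimensional systems: a linear map with a Kraus representation
`ρ ↦ ∑ j, K j * ρ * (K j)ᴴ` whose Kraus operators satisfy `∑ j, (K j)ᴴ * K j = 1`
(trace preservation). -/
def IsQuantumChannel {n : ℕ}
    (Φ : Matrix (Fin n) (Fin n) ℂ →ₗ[ℂ] Matrix (Fin n) (Fin n) ℂ) : Prop :=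
  ∃ (d : ℕ) (K : Fin d → Matrix (Fin n) (Fin n) ℂ),
    ∑ j, (K j)ᴴ * K j = 1 ∧ ∀ ρ, Φ ρ = ∑ j, K j * ρ * (K j)ᴴ

/-- The fidelity `F(ρ, σ) = Tr √(ρ^{1/2} σ ρ^{1/2})` of positive semidefinite matrices
(the trace is a nonnegative real number). -/
def fidelity {ι : Type} [Fintype ι] [DecidableEq ι] (ρ σ : Matrix ι ι ℂ) : ℝ :=
  (Matrix.trace (CFC.sqrt (CFC.sqrt ρ * σ * CFC.sqrt ρ))).re

/-- The projector `|ψ⟩⟨ψ|`. -/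
def pureState {ι : Type} (ψ : ι → ℂ) : Matrix ι ι ℂ :=
  Matrix.vecMulVec ψ (star ψ)

/-- The map `I_A ⊗ Φ_B`: `Φ` is applied to each block `⟨a| X |a'⟩` of a matrix `X` on `A ⊗ B`. -/
def idTensor {α : Type} {n : ℕ}
    (Φ : Matrix (Fin n) (Fin n) ℂ →ₗ[ℂ] Matrix (Fin n) (Fin n) ℂ)
    (X : Matrix (α × Fin n) (α × Fin n) ℂ) : Matrix (α × Fin n) (α × Fin n) ℂ :=
  Matrix.of fun p q => Φ (Matrix.of fun b b' => X (p.1, b) (q.1, b')) p.2 q.2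

/-- The minimum entanglement fidelity: the least fidelity between `|Ψ⟩⟨Ψ|` and
`(I_A ⊗ Φ_B)(|Ψ⟩⟨Ψ|)` over all unit vectors `Ψ` of `A ⊗ B`, with `A` of any finite dimension. -/
def minEntanglementFidelity {n : ℕ}
    (Φ : Matrix (Fin n) (Fin n) ℂ →ₗ[ℂ] Matrix (Fin n) (Fin n) ℂ) : ℝ :=
  sInf {f : ℝ | ∃ (m : ℕ) (Ψ : Fin m × Fin n → ℂ), star Ψ ⬝ᵥ Ψ = 1 ∧
    f = fidelity (pureState Ψ) (idTensor Φ (pureState Ψ))}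

/-- The time-energy cost `max |θ|` of a unitary matrix, over all angles `θ ∈ (-π, π]` such that
`exp (-i θ)` is an eigenvalue. -/
def unitaryCost {ι : Type} [Fintype ι] [DecidableEq ι] (U : Matrix ι ι ℂ) : ℝ :=
  sSup {x : ℝ | ∃ θ ∈ Set.Ioc (-Real.pi) Real.pi,
    Module.End.HasEigenvalue (Matrix.toLin' U) (Complex.exp (-(Complex.I * (θ : ℂ)))) ∧ x = |θ|}

/-- The partial trace over the first tensor factor `C` of `C ⊗ B`. -/
def partialTraceLeft {γ β : Type} [Fintype γ] (X : Matrix (γ × β) (γ × β) ℂ) : Matrix β β ℂ :=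
  Matrix.of fun b b' => ∑ c, X (c, b) (c, b')

/-- `U` is a unitary extension of `Φ`, with an ancilla `C` of dimension `m + 1` prepared in `|0⟩`:
`Φ(ρ) = Tr_C [U (|0⟩⟨0| ⊗ ρ) U†]`. This is an equality of linear maps in `ρ`, so it is the same to
ask for it on density matrices, which span. -/
def IsUnitaryExtension {n m : ℕ}
    (Φ : Matrix (Fin n) (Fin n) ℂ →ₗ[ℂ] Matrix (Fin n) (Fin n) ℂ)
    (U : Matrix (Fin (m + 1) × Fin n) (Fin (m + 1) × Fin n) ℂ) : Prop :=
  U ∈ Matrix.unitaryGroup (Fin (m + 1) × Fin n) ℂ ∧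
    ∀ ρ : Matrix (Fin n) (Fin n) ℂ,
      Φ ρ = partialTraceLeft
        (U * (Matrix.single (0 : Fin (m + 1)) (0 : Fin (m + 1)) (1 : ℂ) ⊗ₖ ρ) * Uᴴ)

/-- The time-energy cost of a channel: the least cost of a unitary extension, over ancillas of any
finite dimension. -/
def channelCost {n : ℕ}
    (Φ : Matrix (Fin n) (Fin n) ℂ →ₗ[ℂ] Matrix (Fin n) (Fin n) ℂ) : ℝ :=
  sInf {c : ℝ | ∃ (m : ℕ) (U : Matrix (Fin (m + 1) × Fin n) (Fin (m + 1) × Fin n) ℂ),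
    IsUnitaryExtension Φ U ∧ c = unitaryCost U}

end

/-! Fix a unitary extension `U`. Its blocks `⟨c|U|0⟩` are Kraus operators of the channel, so the
squared fidelity of a unit vector `Ψ` with its image is `∑ c, |z c|²`, where `z c` is the
expectation of the `c`-th block in `Ψ`. Keeping only `c = 0`, the fidelity is at least `Re (z 0)`,
and `z 0` is the expectation of `I ⊗ U` in `Ψ` with the ancilla in `|0⟩`. As `U` is normal, this
real part is at least the least real part of an eigenvalue, hence at least `cos ‖U‖`
(`cos_unitaryCost_le_fidelity`). Continuity of the cosine carries the bound to the infimum over `U`.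
-/

/-- The block `⟨c| U |0⟩` of a matrix on `C ⊗ B`. -/
def ancillaBlock {n m : ℕ} (U : Matrix (Fin (m + 1) × Fin n) (Fin (m + 1) × Fin n) ℂ)
    (c : Fin (m + 1)) : Matrix (Fin n) (Fin n) ℂ :=
  Matrix.of fun b b' => U (c, b) (0, b')

theorem partialTraceLeft_conj_single_kronecker {n m : ℕ}
    (U : Matrix (Fin (m + 1) × Fin n) (Fin (m + 1) × Fin n) ℂ) (ρ : Matrix (Fin n) (Fin n) ℂ) :
    partialTraceLeft
        (U * (Matrix.single (0 : Fin (m + 1)) (0 : Fin (m + 1)) (1 : ℂ) ⊗ₖ ρ) * Uᴴ) =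
      ∑ c, ancillaBlock U c * ρ * (ancillaBlock U c)ᴴ := by
  ext b b'
  simp only [partialTraceLeft, Matrix.of_apply, Matrix.sum_apply]
  refine Finset.sum_congr rfl fun c _ => ?_
  simp only [Matrix.mul_apply, Fintype.sum_prod_type, Matrix.kroneckerMap_apply,
    Matrix.single_apply, ancillaBlock, Matrix.of_apply, Matrix.conjTranspose_apply]
  rw [Finset.sum_eq_single 0]
  · refine Finset.sum_congr rfl fun j _ => ?_
    congr 1
    rw [Finset.sum_eq_single 0]
    · simp
    · intro c' _ hc'
      simp [hc'.symm]
    · simp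
  · intro c' _ hc'
    simp [hc'.symm]
  · simp

/-- Stinespring dilation: every channel on a nontrivial system has a unitary extension. -/
theorem IsQuantumChannel.exists_isUnitaryExtension {n : ℕ} (hn : 1 ≤ n)
    {Φ : Matrix (Fin n) (Fin n) ℂ →ₗ[ℂ] Matrix (Fin n) (Fin n) ℂ} (hΦ : IsQuantumChannel Φ) :
    ∃ (m : ℕ) (U : Matrix (Fin (m + 1) × Fin n) (Fin (m + 1) × Fin n) ℂ),
      IsUnitaryExtension Φ U := by
  obtain ⟨d, K, hK, hΦK⟩ := hΦ
  obtain _ | m := d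
  · have h := congrFun (congrFun hK ⟨0, hn⟩) ⟨0, hn⟩
    simp at h
  -- Stacking the Kraus operators prescribes the columns `(0, b)` of `U`; trace preservation says
  -- exactly that these are orthonormal. The remaining columns complete the basis.
  let v : Fin (m + 1) × Fin n → EuclideanSpace ℂ (Fin (m + 1) × Fin n) :=
    fun i => WithLp.toLp 2 fun p => K p.1 p.2 i.2
  let s : Set (Fin (m + 1) × Fin n) := {i | i.1 = 0}
  have hv : Orthonormal ℂ (s.domRestrict v) := by
    rw [orthonormal_iff_ite]
    rintro ⟨⟨i, i'⟩, hi⟩ ⟨⟨j, j'⟩, hj⟩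
    have hi : i = 0 := hi
    have hj : j = 0 := hj
    subst hi hj
    have h := congrFun (congrFun hK i') j'
    simp only [Matrix.sum_apply, Matrix.mul_apply, Matrix.conjTranspose_apply,
      Matrix.one_apply] at h
    simp only [v, PiLp.inner_apply, Fintype.sum_prod_type, RCLike.inner_apply,
      Subtype.mk.injEq, Prod.mk.injEq, true_and]
    rw [← h]
    exact Finset.sum_congr rfl fun c _ => Finset.sum_congr rfl fun b _ => mul_comm _ _
  obtain ⟨e, he⟩ := hv.exists_orthonormalBasis_extension_of_card_eq (by simp)
  let U : Matrix (Fin (m + 1) × Fin n) (Fin (m + 1) × Fin n) ℂ := Matrix.of fun p i => e i p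
  refine ⟨m, U, ?_, fun ρ => ?_⟩
  · rw [Matrix.mem_unitaryGroup_iff']
    ext i j
    have h := orthonormal_iff_ite.1 e.orthonormal i j
    simp only [PiLp.inner_apply, RCLike.inner_apply] at h
    rw [Matrix.star_eq_conjTranspose, Matrix.one_apply, ← h, Matrix.mul_apply]
    exact Finset.sum_congr rfl fun p _ => mul_comm _ _
  · rw [partialTraceLeft_conj_single_kronecker, hΦK]
    have hU : ∀ c, ancillaBlock U c = K c := by
      intro c
      ext b b'
      simp [ancillaBlock, U, he (0, b') rfl, v]
    simp [hU]

theorem pureState_posSemidef {ι : Type} [Fintype ι] (ψ : ι → ℂ) : (pureState ψ).PosSemidef :=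
  Matrix.posSemidef_vecMulVec_self_star ψ

theorem pureState_mul_self {ι : Type} [Fintype ι] {ψ : ι → ℂ} (hψ : star ψ ⬝ᵥ ψ = 1) :
    pureState ψ * pureState ψ = pureState ψ := by
  rw [pureState, Matrix.vecMulVec_mul_vecMulVec, hψ, one_smul]

theorem sqrt_pureState {ι : Type} [Fintype ι] [DecidableEq ι] {ψ : ι → ℂ}
    (hψ : star ψ ⬝ᵥ ψ = 1) : CFC.sqrt (pureState ψ) = pureState ψ :=
  CFC.sqrt_unique (pureState_mul_self hψ) (pureState_posSemidef ψ).nonneg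

/-- The fidelity with a pure state is the square root of the overlap. -/
theorem fidelity_pureState_left {ι : Type} [Fintype ι] [DecidableEq ι] {ψ : ι → ℂ}
    (hψ : star ψ ⬝ᵥ ψ = 1) (σ : Matrix ι ι ℂ) {t : ℝ} (ht : 0 ≤ t)
    (hσ : star ψ ⬝ᵥ (σ *ᵥ ψ) = t) : fidelity (pureState ψ) σ = Real.sqrt t := by
  have h1 : pureState ψ * σ * pureState ψ = (t : ℂ) • pureState ψ := by
    rw [pureState, Matrix.mul_assoc, Matrix.mul_vecMulVec, Matrix.vecMulVec_mul_vecMulVec, hσ,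
      Matrix.vecMulVec_smul]
  have h2 : CFC.sqrt ((t : ℂ) • pureState ψ) = ((Real.sqrt t : ℝ) : ℂ) • pureState ψ := by
    refine CFC.sqrt_unique ?_ ?_
    · rw [smul_mul_smul_comm, pureState_mul_self hψ, ← Complex.ofReal_mul, Real.mul_self_sqrt ht]
    · exact ((pureState_posSemidef ψ).smul
        (Complex.zero_le_real.2 (Real.sqrt_nonneg t))).nonneg
  rw [fidelity, sqrt_pureState hψ, h1, h2, Matrix.trace_smul, pureState, Matrix.trace_vecMulVec,
    dotProduct_comm, hψ]
  simp

theorem exists_exp_eq_of_mem_unitaryGroup {ι : Type} [Fintype ι] [DecidableEq ι]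
    {U : Matrix ι ι ℂ} (hU : U ∈ Matrix.unitaryGroup ι ℂ) {μ : ℂ}
    (hμ : μ ∈ spectrum ℂ U) :
    ∃ θ ∈ Set.Ioc (-Real.pi) Real.pi, Complex.exp (-(Complex.I * (θ : ℂ))) = μ := by
  open scoped Matrix.Norms.L2Operator in
  have hnorm : ‖μ‖ = 1 := by
    simpa using Unitary.spectrum_subset_circle ⟨U, hU⟩ hμ
  have hinv : ‖(starRingEnd ℂ) μ‖ = 1 := by simpa using hnorm
  -- Conjugating before taking `arg` matches the sign in `exp (-iθ)` and keeps `π` in the range.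
  refine ⟨((starRingEnd ℂ) μ).arg, Complex.arg_mem_Ioc _, ?_⟩
  have h := Complex.norm_mul_exp_arg_mul_I ((starRingEnd ℂ) μ)
  rw [hinv, Complex.ofReal_one, one_mul] at h
  have h' := congrArg (starRingEnd ℂ) h
  rw [← Complex.exp_conj] at h'
  simpa [mul_comm] using h'

theorem abs_le_unitaryCost {ι : Type} [Fintype ι] [DecidableEq ι] {U : Matrix ι ι ℂ} {θ : ℝ}
    (hθ : θ ∈ Set.Ioc (-Real.pi) Real.pi)
    (h : Module.End.HasEigenvalue (Matrix.toLin' U) (Complex.exp (-(Complex.I * (θ : ℂ))))) :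
    |θ| ≤ unitaryCost U := by
  refine le_csSup ⟨Real.pi, ?_⟩ ⟨θ, hθ, h, rfl⟩
  rintro _ ⟨φ, hφ, -, rfl⟩
  exact abs_le.2 ⟨hφ.1.le, hφ.2⟩

theorem unitaryCost_nonneg {ι : Type} [Fintype ι] [DecidableEq ι] (U : Matrix ι ι ℂ) :
    0 ≤ unitaryCost U :=
  Real.sSup_nonneg (by rintro _ ⟨θ, -, -, rfl⟩; exact abs_nonneg θ)

theorem unitaryCost_le_pi {ι : Type} [Fintype ι] [DecidableEq ι] (U : Matrix ι ι ℂ) :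
    unitaryCost U ≤ Real.pi := by
  refine Real.sSup_le ?_ Real.pi_pos.le
  rintro _ ⟨θ, hθ, -, rfl⟩
  exact abs_le.2 ⟨hθ.1.le, hθ.2⟩

/-- An eigenvalue `exp (-iθ)` has real part `cos |θ|`, and the cosine decreases on `[0, π]`. -/
theorem cos_unitaryCost_le_re_of_mem_spectrum {ι : Type} [Fintype ι] [DecidableEq ι]
    {U : Matrix ι ι ℂ} (hU : U ∈ Matrix.unitaryGroup ι ℂ) {μ : ℂ} (hμ : μ ∈ spectrum ℂ U) :
    Real.cos (unitaryCost U) ≤ μ.re := by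
  obtain ⟨θ, hθ, rfl⟩ := exists_exp_eq_of_mem_unitaryGroup hU hμ
  have hev : Module.End.HasEigenvalue (Matrix.toLin' U)
      (Complex.exp (-(Complex.I * (θ : ℂ)))) := by
    rw [Module.End.hasEigenvalue_iff_mem_spectrum, Matrix.spectrum_toLin']
    exact hμ
  have hre : (Complex.exp (-(Complex.I * (θ : ℂ)))).re = Real.cos |θ| := by
    rw [Complex.exp_re]
    simp
  rw [hre]
  exact Real.cos_le_cos_of_nonneg_of_le_pi (abs_nonneg θ) (unitaryCost_le_pi U)
    (abs_le_unitaryCost hθ hev)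

/-- A lower bound for the real part on the spectrum of a normal matrix is a lower bound for its
numerical range. -/
theorem IsStarNormal.re_dotProduct_mulVec_ge {ι : Type} [Fintype ι] [DecidableEq ι]
    {A : Matrix ι ι ℂ} (hA : IsStarNormal A) {c : ℝ} (hc : ∀ μ ∈ spectrum ℂ A, c ≤ μ.re)
    (x : ι → ℂ) : c * (star x ⬝ᵥ x).re ≤ (star x ⬝ᵥ (A *ᵥ x)).re := by
  open scoped Matrix.Norms.L2Operator in
  -- By functional calculus `A + A† - 2c` is positive semidefinite, since its symbol `2 (Re z - c)`
  -- is nonnegative on the spectrum.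
  have h : 0 ≤ cfc (fun z : ℂ => z + star z - ((2 * c : ℝ) : ℂ)) A := by
    refine cfc_nonneg fun μ hμ => ?_
    have h2 : μ + star μ - ((2 * c : ℝ) : ℂ) = ((2 * (μ.re - c) : ℝ) : ℂ) := by
      apply Complex.ext <;> simp; ring
    rw [h2]
    exact Complex.zero_le_real.2 (by linarith [hc μ hμ])
  open scoped Matrix.Norms.L2Operator in
  rw [cfc_sub (fun z : ℂ => z + star z) (fun _ => ((2 * c : ℝ) : ℂ)) A,
    cfc_add A (fun z : ℂ => z) (fun z : ℂ => star z), cfc_id' ℂ A, cfc_star_id (R := ℂ) A,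
    cfc_const ((2 * c : ℝ) : ℂ) A] at h
  have h3 := (Complex.nonneg_iff.1 ((Matrix.nonneg_iff_posSemidef.1 h).dotProduct_mulVec_nonneg x)).1
  have h4 : star x ⬝ᵥ (star A *ᵥ x) = star (star x ⬝ᵥ (A *ᵥ x)) := by
    rw [Matrix.star_dotProduct, Matrix.star_mulVec, Matrix.star_eq_conjTranspose,
      Matrix.conjTranspose_conjTranspose, ← Matrix.dotProduct_mulVec]
  rw [Algebra.algebraMap_eq_smul_one, Matrix.sub_mulVec, Matrix.add_mulVec, Matrix.smul_mulVec,
    Matrix.one_mulVec, dotProduct_sub, dotProduct_add, dotProduct_smul, h4] at h3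
  simp at h3
  linarith

/-- The output is the sum of the unnormalised pure states `χ c = (I ⊗ K_c) Ψ`, and each contributes
`|⟨Ψ|χ c⟩|²`. -/
theorem isUnitaryExtension_overlap {n m k : ℕ}
    {Φ : Matrix (Fin n) (Fin n) ℂ →ₗ[ℂ] Matrix (Fin n) (Fin n) ℂ}
    {U : Matrix (Fin (m + 1) × Fin n) (Fin (m + 1) × Fin n) ℂ} (hU : IsUnitaryExtension Φ U)
    (Ψ : Fin k × Fin n → ℂ) :
    star Ψ ⬝ᵥ (idTensor Φ (pureState Ψ) *ᵥ Ψ) =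
      ((∑ c, Complex.normSq
        (∑ a, star (fun b => Ψ (a, b)) ⬝ᵥ (ancillaBlock U c *ᵥ fun b => Ψ (a, b))) : ℝ) : ℂ) := by
  let χ : Fin (m + 1) → Fin k × Fin n → ℂ := fun c p =>
    (ancillaBlock U c *ᵥ fun b => Ψ (p.1, b)) p.2
  have h1 : idTensor Φ (pureState Ψ) = ∑ c, pureState (χ c) := by
    ext p q
    have : (Matrix.of fun b b' => pureState Ψ (p.1, b) (q.1, b')) =
        Matrix.vecMulVec (fun b => Ψ (p.1, b)) (star fun b => Ψ (q.1, b)) := rfl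
    simp only [idTensor, Matrix.of_apply]
    rw [this, hU.2, partialTraceLeft_conj_single_kronecker, Matrix.sum_apply, Matrix.sum_apply]
    refine Finset.sum_congr rfl fun c _ => ?_
    rw [Matrix.mul_vecMulVec, Matrix.vecMulVec_mul, ← Matrix.star_mulVec]
    rfl
  have h2 : ∀ c, star Ψ ⬝ᵥ χ c =
      ∑ a, star (fun b => Ψ (a, b)) ⬝ᵥ (ancillaBlock U c *ᵥ fun b => Ψ (a, b)) := fun c => by
    simp only [dotProduct, Fintype.sum_prod_type]
    rfl
  rw [h1, Matrix.sum_mulVec, dotProduct_sum, Complex.ofReal_sum]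
  refine Finset.sum_congr rfl fun c _ => ?_
  have h3 : star (χ c) ⬝ᵥ Ψ = star (star Ψ ⬝ᵥ χ c) := by
    rw [Matrix.star_dotProduct]
  rw [← h2, pureState, Matrix.vecMulVec_mulVec, h3, Complex.normSq_eq_conj_mul_self,
    dotProduct_smul]
  simp [mul_comm]

theorem dotProduct_ancillaBlock_zero {n m : ℕ}
    (U : Matrix (Fin (m + 1) × Fin n) (Fin (m + 1) × Fin n) ℂ) (ψ : Fin n → ℂ) :
    star ψ ⬝ᵥ (ancillaBlock U 0 *ᵥ ψ) =
      star (fun p : Fin (m + 1) × Fin n => if p.1 = 0 then ψ p.2 else 0) ⬝ᵥ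
        (U *ᵥ fun p => if p.1 = 0 then ψ p.2 else 0) := by
  simp [dotProduct, Matrix.mulVec, Fintype.sum_prod_type_right, ancillaBlock, apply_ite]

theorem cos_unitaryCost_le_fidelity {n m k : ℕ}
    {Φ : Matrix (Fin n) (Fin n) ℂ →ₗ[ℂ] Matrix (Fin n) (Fin n) ℂ}
    {U : Matrix (Fin (m + 1) × Fin n) (Fin (m + 1) × Fin n) ℂ} (hU : IsUnitaryExtension Φ U)
    {Ψ : Fin k × Fin n → ℂ} (hΨ : star Ψ ⬝ᵥ Ψ = 1) :
    Real.cos (unitaryCost U) ≤ fidelity (pureState Ψ) (idTensor Φ (pureState Ψ)) := by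
  rw [fidelity_pureState_left hΨ _ (Finset.sum_nonneg fun c _ => Complex.normSq_nonneg _)
    (isUnitaryExtension_overlap hU Ψ)]
  set z : Fin (m + 1) → ℂ := fun c =>
    ∑ a, star (fun b => Ψ (a, b)) ⬝ᵥ (ancillaBlock U c *ᵥ fun b => Ψ (a, b)) with hz
  have hnormal : IsStarNormal U :=
    ⟨(Unitary.star_mul_self_of_mem hU.1).trans (Unitary.mul_star_self_of_mem hU.1).symm⟩
  -- The numerical range bound is homogeneous, so the slices of `Ψ` need no normalisation; their
  -- squared norms sum to 1.
  have hblock : ∀ a, Real.cos (unitaryCost U) * (star (fun b => Ψ (a, b)) ⬝ᵥ fun b => Ψ (a, b)).re ≤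
      (star (fun b => Ψ (a, b)) ⬝ᵥ (ancillaBlock U 0 *ᵥ fun b => Ψ (a, b))).re := fun a => by
    have h := hnormal.re_dotProduct_mulVec_ge
      (fun μ hμ => cos_unitaryCost_le_re_of_mem_spectrum hU.1 hμ)
      (fun p : Fin (m + 1) × Fin n => if p.1 = 0 then Ψ (a, p.2) else 0)
    rw [dotProduct_ancillaBlock_zero]
    refine le_trans (le_of_eq ?_) h
    congr 2
    simp [dotProduct, Fintype.sum_prod_type_right, apply_ite]
  have hone : ∑ a, (star (fun b => Ψ (a, b)) ⬝ᵥ fun b => Ψ (a, b)).re = 1 := by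
    rw [← Complex.re_sum, ← Complex.one_re, ← hΨ]
    simp [dotProduct, Fintype.sum_prod_type]
  calc Real.cos (unitaryCost U) ≤ (z 0).re := by
        rw [hz, Complex.re_sum, ← mul_one (Real.cos _), ← hone, Finset.mul_sum]
        exact Finset.sum_le_sum fun a _ => hblock a
    _ ≤ ‖z 0‖ := Complex.re_le_norm _
    _ ≤ Real.sqrt (∑ c, Complex.normSq (z c)) := by
        refine Real.le_sqrt_of_sq_le ?_
        rw [← Complex.normSq_eq_norm_sq]
        exact Finset.single_le_sum (f := fun c => Complex.normSq (z c))
          (fun c _ => Complex.normSq_nonneg _) (Finset.mem_univ 0)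

theorem theorem3 (n : ℕ) (hn : 1 ≤ n)
    (Φ : Matrix (Fin n) (Fin n) ℂ →ₗ[ℂ] Matrix (Fin n) (Fin n) ℂ)
    (hΦ : IsQuantumChannel Φ) :
    minEntanglementFidelity Φ ≥ Real.cos (channelCost Φ) := by
  have hne : {f : ℝ | ∃ (m : ℕ) (Ψ : Fin m × Fin n → ℂ), star Ψ ⬝ᵥ Ψ = 1 ∧
      f = fidelity (pureState Ψ) (idTensor Φ (pureState Ψ))}.Nonempty :=
    ⟨_, 1, Pi.single (0, ⟨0, hn⟩) 1, by simp, rfl⟩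
  refine le_csInf hne ?_
  rintro _ ⟨k, Ψ, hΨ, rfl⟩
  set S : Set ℝ := {c : ℝ | ∃ (m : ℕ)
    (U : Matrix (Fin (m + 1) × Fin n) (Fin (m + 1) × Fin n) ℂ),
    IsUnitaryExtension Φ U ∧ c = unitaryCost U} with hS
  have hSne : S.Nonempty := by
    obtain ⟨m, U, hU⟩ := hΦ.exists_isUnitaryExtension hn
    exact ⟨_, m, U, hU, rfl⟩
  have hSbdd : BddBelow S := ⟨0, by rintro _ ⟨m, U, -, rfl⟩; exact unitaryCost_nonneg U⟩
  -- The infimum over extensions need not be attained, but it lies in the closure of the costs.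
  have hclosed : IsClosed {c : ℝ | Real.cos c ≤
      fidelity (pureState Ψ) (idTensor Φ (pureState Ψ))} :=
    isClosed_le Real.continuous_cos continuous_const
  refine hclosed.closure_subset_iff.2 ?_ (csInf_mem_closure hSne hSbdd)
  rintro _ ⟨m, U, hU, rfl⟩
  exact cos_unitaryCost_le_fidelity hU hΨ
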